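/- Let $(m_j)_{j\ge1},(n_j)_{j\ge1}$ be given by $m_1=2$, $m_{j+1}=m_j^4$, $n_1=4$, $n_{j+1}=(4n_j)^{s_j}$ with $s_j=\log_2 (m_{j+1}^3)$. Fix any function $\varrho:[\omega_1]^2\to\omega$ such that for all $\alpha<\beta<\gamma<\omega_1$ and $k\in\omega$: $\varrho(\alpha,\gamma)\le\max\{\varrho(\alpha,\beta),\varrho(\beta,\gamma)\}$, $\varrho(\alpha,\beta)\le\max\{\varrho(\alpha,\gamma),\varrho(\beta,\gamma)\}$, and $\{\xi<\beta:\varrho(\xi,\beta)\le k\}$ is finite. For a linearly ordered set $A$, a sequence in $c_{00}(A)$ is a block sequence if the supports of its terms are successive. A block sequence $(\phi_i)_{i=1}^d$ in $c_{00}(\omega_1)$ is *separated* if $\varrho(\alpha,\beta)\ge|\bigcup_l\operatorname{supp}\phi_l|$ whenever $\alpha\in\operatorname{supp}\phi_i$, $\beta\in\operatorname{supp}\phi_k$, $i<k$. *Coding.* Let $\mathbb Q_s$ be the set of sequences $(\phi_1,w_1,p_1,\dots,\phi_d,w_d,p_d)$, $d\ge1$, with $(\phi_i)$ a block sequence of non-zero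 vectors of $c_{00}(\omega)$ with rational coordinates and with $(w_i),(p_i)$ strictly increasing sequences of natural numbers. Let $\mathbb Q_s(\omega_1)$ be defined in the same way with $c_{00}(\omega_1)$ in place of $c_{00}(\omega)$ and with the additional requirement that $p_i\ge\varrho(\alpha,\beta)$ for all $i\le d$ and all $\alpha<\beta$ in $\bigcup_{k\le i}\operatorname{supp}\phi_k$. Fix any injection $\sigma:\mathbb Q_s\to\{2j:j\text{ odd}\}$ with $\sigma(\phi_1,w_1,p_1,\dots,\phi_d,w_d,p_d)>\max\{p_d^2,\varepsilon^{-2},\max\operatorname{supp}\phi_d\}$, where $\varepsilon$ is the least absolute value of a non-zero coordinate of $\phi_1,\dots,\phi_d$. For $s=(\phi_1,w_1,p_1,\dots,\phi_d,w_d,p_d)\in\mathbb Q_s(\omega_1)$ let $G_s$ be the (finite) set of all $\alpha$ for which there is $\beta\in\bigcup_i\operatorname{supp}\phi_i$ with $\alpha=\beta$, or $\alpha<\beta$ and $\varrho(\alpha,\beta)\le p_d$; let $\sigma_\varrho(s)$ be the value of $\sigma$ at the sequence obtained from $s$ by transporting each $\phi_i$ along the increasing bijection $G_s\to\{0,\dots,|G_s|-1\}$.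 *Norming set.* Let $K\subseteq c_{00}(\omega_1)$ be the smallest set such that (i) $K$ contains $e^*_\gamma$ for every $\gamma<\omega_1$, is symmetric, and is closed under restrictions to intervals of $\omega_1$; (ii) if $j\ge1$, $d\le n_{2j}$ and $(\phi_i)_{i=1}^d$ is a separated block sequence in $K$, then $\phi=\frac1{m_{2j}}\sum_{i=1}^d\phi_i\in K$; such a $\phi$ is said to have weight $m_{2j}$; (iii) if $j\ge1$, $d\le n_{2j+1}$ and $(\phi_i)_{i=1}^d$ is a separated $(2j+1)$-special sequence in $K$, then $\frac1{m_{2j+1}}\sum_{i=1}^d\phi_i\in K$. Here a block sequence $(\phi_i)_{i=1}^d$ of non-zero elements of $K$ is *$(2j+1)$-special* if there are natural numbers $k_i$ and $p_i$ such that each $\phi_i$ has weight $w_i=m_{2k_i}$; $k_1$ is even with $m_{2k_1}>n_{2j+1}^2$; and, for $1\le i<d$, the sequence $(\phi_1,w_1,p_1,\dots,\phi_i,w_i,p_i)$ is in $\mathbb Q_s(\omega_1)$ and its value under $\sigma_\varrho$ is $2k_{i+1}$; (iv) $K$ is closed under rational convex combinations. Let $\mathfrak X$ be the (real) completion of $c_{00}(\omega_1)$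 under the norm $\|x\|=\sup\{\sum_\alpha\phi(\alpha)x(\alpha):\phi\in K\}$. **Corollary.** $\mathfrak X$ is not distortable: for every equivalent norm $|||\cdot|||$ on $\mathfrak X$, $$d(\mathfrak X,|||\cdot|||)=\inf_Y\ \sup\Big\{\frac{|||x|||}{|||y|||}: x,y\in Y,\ \|x\|=\|y\|=1\Big\}=1,$$ where the infimum is over all infinite dimensional subspaces $Y$ of $\mathfrak X$. -/

import Mathlib

namespace LongC0

open scoped ENNReal

/-- The set of countable ordinals, with its well-ordering. -/
abbrev Omega1 : Type := (Ordinal.omega 1 : Ordinal.{0}).ToType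

/-! ### The sequences of parameters -/

/-- `m_1 = 2` and `m_{j+1} = m_j ^ 4` (the value at `0` is never used). -/
def m : ℕ → ℕ
  | 0 => 1
  | 1 => 2
  | (j + 2) => m (j + 1) ^ 4

/-- `n_1 = 4` and `n_{j+1} = (4 n_j) ^ {s_j}` with `s_j = log_2 (m_{j+1}^3)`
(the value at `0` is never used; the logarithm is exact, `m_{j+1}` being a power of `2`). -/
def n : ℕ → ℕ
  | 0 => 1
  | 1 => 4
  | (j + 2) => (4 * n (j + 1)) ^ Nat.log 2 (m (j + 2) ^ 3)

/-! ### The function `ϱ : [ω₁]² → ω` -/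

/-- The three properties of a `ϱ`-function; only the values at pairs `α < β` matter. -/
structure IsRhoFunction (rho : Omega1 → Omega1 → ℕ) : Prop where
  triangle_left : ∀ α β γ : Omega1, α < β → β < γ → rho α γ ≤ max (rho α β) (rho β γ)
  triangle_right : ∀ α β γ : Omega1, α < β → β < γ → rho α β ≤ max (rho α γ) (rho β γ)
  finite_below : ∀ (β : Omega1) (k : ℕ), {α : Omega1 | α < β ∧ rho α β ≤ k}.Finite

/-! ### Block sequences and separated sequences -/

/-- `f < g`: every element of the support of `f` is below every element of that of `g`. -/
def Before {A : Type} [LinearOrder A] (f g : A →₀ ℚ) : Prop :=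
  ∀ α ∈ f.support, ∀ β ∈ g.support, α < β

/-- `(φ_i)_{i < d}` is a block sequence. -/
def IsBlock {A : Type} [LinearOrder A] (d : ℕ) (φ : ℕ → A →₀ ℚ) : Prop :=
  ∀ i k, i < k → k < d → Before (φ i) (φ k)

/-- `(φ_i)_{i < d}` is a block sequence whose supports are pairwise `p`-separated, where
`p` is the cardinality of the union of the supports. In a block sequence the elements of an
earlier support are below those of a later one, so `ϱ` is only used at increasing pairs. -/
def IsSeparatedBlock (rho : Omega1 → Omega1 → ℕ) (d : ℕ) (φ : ℕ → Omega1 →₀ ℚ) : Prop :=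
  IsBlock d φ ∧
    ∀ i k, i < k → k < d → ∀ α ∈ (φ i).support, ∀ β ∈ (φ k).support,
      ((Finset.range d).biUnion fun l => (φ l).support).card ≤ rho α β

/-! ### The coding of finite sequences `(φ_1, w_1, p_1, …, φ_d, w_d, p_d)` -/

/-- Finite sequences `(φ_1, w_1, p_1, …, φ_d, w_d, p_d)` of rational finitely supported functions
on `A` and natural numbers. -/
abbrev CodeSeq (A : Type) : Type := List ((A →₀ ℚ) × ℕ × ℕ)

/-- Non-empty sequences for which `(φ_i)` is a block sequence of non-zero vectors and `(w_i)`,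
`(p_i)` are strictly increasing. For `A = ℕ` this is the domain of the coding `σ`. -/
structure IsCodeSeq {A : Type} [LinearOrder A] (s : CodeSeq A) : Prop where
  ne_nil : s ≠ []
  ne_zero : ∀ t ∈ s, t.1 ≠ 0
  block : s.Pairwise fun t u => Before t.1 u.1
  weights : s.Pairwise fun t u => t.2.1 < u.2.1
  numbers : s.Pairwise fun t u => t.2.2 < u.2.2

/-- The domain of the coding `σ_ϱ`: sequences over `ω₁` as above with
`p_i ≥ max {ϱ(α, β) : α, β ∈ supp φ_1 ∪ ⋯ ∪ supp φ_i}` for all `i`. -/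
structure IsRhoCodeSeq (rho : Omega1 → Omega1 → ℕ) (s : CodeSeq Omega1) : Prop
    extends IsCodeSeq s where
  rho_le : ∀ i k l : Fin s.length, k ≤ i → l ≤ i →
    ∀ α ∈ (s.get k).1.support, ∀ β ∈ (s.get l).1.support, α < β → rho α β ≤ (s.get i).2.2

/-- `σ` is an injective coding of the sequences over `ℕ` with values in `{2j : j odd}` and
`σ(φ_1, w_1, p_1, …, φ_d, w_d, p_d) > max {p_d², 1/ε², max supp φ_d}`, where
`ε = min {|φ_k(i)| : k ≤ d, i ∈ supp φ_k}`. -/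
structure IsCoding (sigma : CodeSeq ℕ → ℕ) : Prop where
  injOn : Set.InjOn sigma {s | IsCodeSeq s}
  value : ∀ s, IsCodeSeq s → ∃ j, Odd j ∧ sigma s = 2 * j
  number_lt : ∀ s, IsCodeSeq s → ∀ t ∈ s, t.2.2 ^ 2 < sigma s
  coord_lt : ∀ s, IsCodeSeq s → ∀ t ∈ s, ∀ i ∈ t.1.support, 1 / (t.1 i) ^ 2 < (sigma s : ℚ)
  support_lt : ∀ s, IsCodeSeq s → ∀ t ∈ s, ∀ i ∈ t.1.support, i < sigma s

/-- The `ϱ`-closure `G_s` of `supp φ_1 ∪ ⋯ ∪ supp φ_d` at level `p_d`: all `α` such that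
`α = β`, or `α < β` and `ϱ(α, β) ≤ p_d`, for some `β` in this union. -/
def rhoClosure (rho : Omega1 → Omega1 → ℕ) (s : CodeSeq Omega1) : Set Omega1 :=
  {α | ∃ t ∈ s, ∃ β ∈ t.1.support, ∃ u ∈ s.getLast?, α = β ∨ (α < β ∧ rho α β ≤ u.2.2)}

/-- The order-preserving enumeration of a finite set `G` of ordinals by `0, …, |G| - 1`. -/
noncomputable def collapse (G : Set Omega1) (α : Omega1) : ℕ := {β | β ∈ G ∧ β < α}.ncard

/-- `σ_ϱ(s)`: the value of `σ` at the sequence over `ℕ` obtained by transporting all `φ_i` along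
the order-preserving enumeration of `G_s` (which contains their supports). -/
noncomputable def sigmaRho (rho : Omega1 → Omega1 → ℕ) (sigma : CodeSeq ℕ → ℕ)
    (s : CodeSeq Omega1) : ℕ :=
  sigma (s.map fun t => (t.1.mapDomain (collapse (rhoClosure rho s)), t.2.1, t.2.2))

/-! ### The norming set -/

/-- `f = (1/m_i) ∑_{k < d} φ_k` is the average of the first `d` terms with weight `m_i`. -/
noncomputable def weighted (i d : ℕ) (φ : ℕ → Omega1 →₀ ℚ) : Omega1 →₀ ℚ :=
  (1 / (m i : ℚ)) • ∑ k ∈ Finset.range d, φ k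

/-- `f` has weight `m_{2j}` relative to `S`: it is `(1/m_{2j}) ∑_{k < d} φ_k` for a separated block
sequence `(φ_k)_{k < d}` in `S` with `d ≤ n_{2j}`. -/
def HasEvenWeight (rho : Omega1 → Omega1 → ℕ) (S : Set (Omega1 →₀ ℚ)) (j : ℕ)
    (f : Omega1 →₀ ℚ) : Prop :=
  1 ≤ j ∧ ∃ (d : ℕ) (φ : ℕ → Omega1 →₀ ℚ), d ≤ n (2 * j) ∧ (∀ k < d, φ k ∈ S) ∧
    IsSeparatedBlock rho d φ ∧ f = weighted (2 * j) d φ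

/-- `(φ_i)_{i < d}` is a `(2j+1)`-special sequence in `S`: a block sequence of non-zero functionals,
where `φ_i` has weight `w_i = m_{2 k_i}`, `k_0` is even and `m_{2 k_0} > n_{2j+1}²`, and where
for suitable numbers `p_i` one has `2 k_{i+1} = σ_ϱ(φ_0, w_0, p_0, …, φ_i, w_i, p_i)`. -/
def IsSpecial (rho : Omega1 → Omega1 → ℕ) (sigma : CodeSeq ℕ → ℕ) (S : Set (Omega1 →₀ ℚ))
    (j d : ℕ) (φ : ℕ → Omega1 →₀ ℚ) : Prop :=
  IsBlock d φ ∧ ∃ (k p : ℕ → ℕ),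
    (∀ i < d, φ i ∈ S ∧ φ i ≠ 0 ∧ HasEvenWeight rho S (k i) (φ i)) ∧
    (0 < d → Even (k 0) ∧ n (2 * j + 1) ^ 2 < m (2 * k 0)) ∧
    ∀ i, i + 1 < d →
      IsRhoCodeSeq rho ((List.range (i + 1)).map fun t => (φ t, m (2 * k t), p t)) ∧
      2 * k (i + 1) =
        sigmaRho rho sigma ((List.range (i + 1)).map fun t => (φ t, m (2 * k t), p t))

open Classical in
/-- The closure conditions defining the norming set. All functionals involved have rational
coordinates, so they are taken in `c₀₀(ω₁)` with rational scalars. -/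
structure IsNormingFamily (rho : Omega1 → Omega1 → ℕ) (sigma : CodeSeq ℕ → ℕ)
    (S : Set (Omega1 →₀ ℚ)) : Prop where
  basis : ∀ γ : Omega1, Finsupp.single γ 1 ∈ S
  symm : ∀ φ ∈ S, -φ ∈ S
  interval : ∀ φ ∈ S, ∀ I : Set Omega1, I.OrdConnected → φ.filter (fun α => α ∈ I) ∈ S
  even : ∀ (j d : ℕ) (φ : ℕ → Omega1 →₀ ℚ), 1 ≤ j → d ≤ n (2 * j) → (∀ k < d, φ k ∈ S) →
    IsSeparatedBlock rho d φ → weighted (2 * j) d φ ∈ S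
  special : ∀ (j d : ℕ) (φ : ℕ → Omega1 →₀ ℚ), 1 ≤ j → d ≤ n (2 * j + 1) →
    (∀ k < d, φ k ∈ S) → IsSeparatedBlock rho d φ → IsSpecial rho sigma S j d φ →
    weighted (2 * j + 1) d φ ∈ S
  convex : Convex ℚ S

/-- The norming set `K`: the smallest set satisfying the closure conditions. -/
def K (rho : Omega1 → Omega1 → ℕ) (sigma : CodeSeq ℕ → ℕ) : Set (Omega1 →₀ ℚ) :=
  ⋂₀ {S | IsNormingFamily rho sigma S}

theorem HasEvenWeight.mono {rho : Omega1 → Omega1 → ℕ} {S T : Set (Omega1 →₀ ℚ)} (h : S ⊆ T)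
    {j : ℕ} {f : Omega1 →₀ ℚ} (hf : HasEvenWeight rho S j f) : HasEvenWeight rho T j f := by
  obtain ⟨hj, d, φ, hd, hS, hb, he⟩ := hf
  exact ⟨hj, d, φ, hd, fun k hk => h (hS k hk), hb, he⟩

theorem IsSpecial.mono {rho : Omega1 → Omega1 → ℕ} {sigma : CodeSeq ℕ → ℕ}
    {S T : Set (Omega1 →₀ ℚ)} (h : S ⊆ T) {j d : ℕ} {φ : ℕ → Omega1 →₀ ℚ}
    (hφ : IsSpecial rho sigma S j d φ) : IsSpecial rho sigma T j d φ := by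
  obtain ⟨hb, k, p, h1, h2, h3⟩ := hφ
  exact ⟨hb, k, p, fun i hi => ⟨h (h1 i hi).1, (h1 i hi).2.1, (h1 i hi).2.2.mono h⟩, h2, h3⟩

/-- The set `K` satisfies the closure conditions itself, so it is the least set that does. -/
theorem isNormingFamily_K (rho : Omega1 → Omega1 → ℕ) (sigma : CodeSeq ℕ → ℕ) :
    IsNormingFamily rho sigma (K rho sigma) where
  basis γ := fun _ hS => hS.basis γ
  symm φ hφ := fun S hS => hS.symm φ (hφ S hS)
  interval φ hφ I hI := fun S hS => hS.interval φ (hφ S hS) I hI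
  even j d φ hj hd hK hb := fun S hS => hS.even j d φ hj hd (fun k hk => hK k hk S hS) hb
  special j d φ hj hd hK hb hs := fun S hS =>
    hS.special j d φ hj hd (fun k hk => hK k hk S hS) hb
      (hs.mono (Set.sInter_subset_of_mem hS))
  convex := convex_sInter fun _ hS => hS.convex

theorem one_le_m (j : ℕ) : 1 ≤ m j := by
  induction j with
  | zero => simp [m]
  | succ j ih =>
    cases j with
    | zero => simp [m]
    | succ j => simpa [m] using Nat.one_le_pow _ _ ih

theorem abs_weighted_le {i d : ℕ} {φ : ℕ → Omega1 →₀ ℚ} (hb : IsBlock d φ)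
    (h : ∀ k < d, ∀ α, |φ k α| ≤ 1) (α : Omega1) : |weighted i d φ α| ≤ 1 := by
  have hm : (1 : ℚ) ≤ m i := by exact_mod_cast one_le_m i
  have key : |∑ k ∈ Finset.range d, φ k α| ≤ 1 := by
    by_cases hz : ∀ k ∈ Finset.range d, φ k α = 0
    · rw [Finset.sum_eq_zero hz]; simp
    · push Not at hz
      obtain ⟨k, hk, hne⟩ := hz
      have hk' := Finset.mem_range.1 hk
      rw [Finset.sum_eq_single_of_mem k hk]
      · exact h k hk' α
      · intro l hl hlk
        by_contra hl0
        have hl' := Finset.mem_range.1 hl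
        rcases lt_or_gt_of_ne hlk with hlt | hlt
        · exact lt_irrefl α (hb l k hlt hk' α (by simpa using hl0) α (by simpa using hne))
        · exact lt_irrefl α (hb k l hlt hl' α (by simpa using hne) α (by simpa using hl0))
  have : weighted i d φ α = (1 / (m i : ℚ)) * ∑ k ∈ Finset.range d, φ k α := by
    simp [weighted]
  rw [this, abs_mul, abs_of_nonneg (by positivity)]
  have h1 : 1 / (m i : ℚ) ≤ 1 := by rw [div_le_one (by linarith)]; exact hm
  have h0 : 0 ≤ 1 / (m i : ℚ) := by positivity
  calc 1 / (m i : ℚ) * |∑ k ∈ Finset.range d, φ k α| ≤ 1 * 1 :=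
        mul_le_mul h1 key (abs_nonneg _) zero_le_one
    _ = 1 := one_mul 1

/-- All elements of `K` have coordinates of absolute value at most one. -/
theorem abs_le_one_of_mem_K {rho : Omega1 → Omega1 → ℕ} {sigma : CodeSeq ℕ → ℕ}
    {φ : Omega1 →₀ ℚ} (hφ : φ ∈ K rho sigma) (α : Omega1) : |φ α| ≤ 1 := by
  classical
  have : IsNormingFamily rho sigma {φ | ∀ α, |φ α| ≤ 1} := by
    refine ⟨?_, ?_, ?_, ?_, ?_, ?_⟩
    · intro γ α
      by_cases h : γ = α <;> simp [h]
    · intro φ h α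
      simpa using h α
    · intro φ h I _ α
      by_cases hα : α ∈ I
      · simpa [Finsupp.filter_apply, hα] using h α
      · simp [hα]
    · intro j d φ _ _ h hb α
      exact abs_weighted_le hb.1 h α
    · intro j d φ _ _ h hb _ α
      exact abs_weighted_le hb.1 h α
    · intro f hf g hg a b ha hb hab α
      calc |(a • f + b • g) α| = |a * f α + b * g α| := by simp
        _ ≤ |a * f α| + |b * g α| := abs_add_le _ _
        _ = a * |f α| + b * |g α| := by rw [abs_mul, abs_mul, abs_of_nonneg ha, abs_of_nonneg hb]
        _ ≤ a * 1 + b * 1 := add_le_add (mul_le_mul_of_nonneg_left (hf α) ha)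
            (mul_le_mul_of_nonneg_left (hg α) hb)
        _ = 1 := by rw [mul_one, mul_one, hab]
  exact hφ _ this α

/-! ### The space -/

/-- `φ(x) = ∑_α φ(α) x(α)`. -/
noncomputable def pairing (φ : Omega1 →₀ ℚ) (x : Omega1 →₀ ℝ) : ℝ :=
  x.sum fun α a => (φ α : ℝ) * a

/-- `‖x‖ = sup {φ(x) : φ ∈ K}`. -/
noncomputable def kNorm (rho : Omega1 → Omega1 → ℕ) (sigma : CodeSeq ℕ → ℕ)
    (x : Omega1 →₀ ℝ) : ℝ :=
  sSup {r | ∃ φ ∈ K rho sigma, r = pairing φ x}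

theorem pairing_add (φ : Omega1 →₀ ℚ) (x y : Omega1 →₀ ℝ) :
    pairing φ (x + y) = pairing φ x + pairing φ y := by
  classical
  exact Finsupp.sum_add_index' (by simp) (by intros; ring)

theorem pairing_smul (φ : Omega1 →₀ ℚ) (a : ℝ) (x : Omega1 →₀ ℝ) :
    pairing φ (a • x) = a * pairing φ x := by
  unfold pairing
  rw [Finsupp.sum_smul_index' (by simp), Finsupp.mul_sum]
  refine Finsupp.sum_congr fun i _ => ?_
  simp only [smul_eq_mul]; ring

theorem pairing_neg (φ : Omega1 →₀ ℚ) (x : Omega1 →₀ ℝ) : pairing (-φ) x = -pairing φ x := by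
  simp [pairing, Finsupp.sum]

theorem pairing_single (γ : Omega1) (x : Omega1 →₀ ℝ) :
    pairing (Finsupp.single γ 1) x = x γ := by
  classical
  unfold pairing
  rw [Finsupp.sum, Finset.sum_eq_single γ]
  · simp
  · intro b _ hb
    simp [hb.symm]
  · intro h
    simp [Finsupp.notMem_support_iff.1 h]

theorem bddAbove_pairing (rho : Omega1 → Omega1 → ℕ) (sigma : CodeSeq ℕ → ℕ)
    (x : Omega1 →₀ ℝ) : BddAbove {r | ∃ φ ∈ K rho sigma, r = pairing φ x} := by
  refine ⟨∑ α ∈ x.support, |x α|, ?_⟩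
  rintro r ⟨φ, hφ, rfl⟩
  refine Finset.sum_le_sum fun α _ => ?_
  have h : |(φ α : ℝ)| ≤ 1 := by exact_mod_cast abs_le_one_of_mem_K hφ α
  calc (φ α : ℝ) * x α ≤ |(φ α : ℝ) * x α| := le_abs_self _
    _ = |(φ α : ℝ)| * |x α| := abs_mul _ _
    _ ≤ 1 * |x α| := mul_le_mul_of_nonneg_right h (abs_nonneg _)
    _ = |x α| := one_mul _

theorem pairing_le_kNorm {rho : Omega1 → Omega1 → ℕ} {sigma : CodeSeq ℕ → ℕ}
    {φ : Omega1 →₀ ℚ} (hφ : φ ∈ K rho sigma) (x : Omega1 →₀ ℝ) :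
    pairing φ x ≤ kNorm rho sigma x :=
  le_csSup (bddAbove_pairing rho sigma x) ⟨φ, hφ, rfl⟩

theorem abs_pairing_le_kNorm {rho : Omega1 → Omega1 → ℕ} {sigma : CodeSeq ℕ → ℕ}
    {φ : Omega1 →₀ ℚ} (hφ : φ ∈ K rho sigma) (x : Omega1 →₀ ℝ) :
    |pairing φ x| ≤ kNorm rho sigma x := by
  refine abs_le'.2 ⟨pairing_le_kNorm hφ x, ?_⟩
  rw [← pairing_neg]
  exact pairing_le_kNorm ((isNormingFamily_K rho sigma).symm φ hφ) x

theorem omega1_nonempty : Nonempty Omega1 :=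
  Ordinal.nonempty_toType_iff.2 (Ordinal.omega_pos 1).ne'

theorem kNorm_le {rho : Omega1 → Omega1 → ℕ} {sigma : CodeSeq ℕ → ℕ} {x : Omega1 →₀ ℝ} {C : ℝ}
    (h : ∀ φ ∈ K rho sigma, pairing φ x ≤ C) : kNorm rho sigma x ≤ C := by
  obtain ⟨γ⟩ := omega1_nonempty
  refine csSup_le ⟨_, _, (isNormingFamily_K rho sigma).basis γ, rfl⟩ ?_
  rintro r ⟨φ, hφ, rfl⟩
  exact h φ hφ

theorem kNorm_nonneg (rho : Omega1 → Omega1 → ℕ) (sigma : CodeSeq ℕ → ℕ) (x : Omega1 →₀ ℝ) :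
    0 ≤ kNorm rho sigma x := by
  obtain ⟨γ⟩ := omega1_nonempty
  exact (abs_nonneg _).trans (abs_pairing_le_kNorm ((isNormingFamily_K rho sigma).basis γ) x)

theorem kNorm_smul_le (rho : Omega1 → Omega1 → ℕ) (sigma : CodeSeq ℕ → ℕ) (a : ℝ)
    (x : Omega1 →₀ ℝ) : kNorm rho sigma (a • x) ≤ |a| * kNorm rho sigma x := by
  refine kNorm_le fun φ hφ => ?_
  rw [pairing_smul]
  calc a * pairing φ x ≤ |a * pairing φ x| := le_abs_self _
    _ = |a| * |pairing φ x| := abs_mul _ _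
    _ ≤ |a| * kNorm rho sigma x :=
      mul_le_mul_of_nonneg_left (abs_pairing_le_kNorm hφ x) (abs_nonneg _)

theorem kNorm_neg (rho : Omega1 → Omega1 → ℕ) (sigma : CodeSeq ℕ → ℕ) (x : Omega1 →₀ ℝ) :
    kNorm rho sigma (-x) = kNorm rho sigma x := by
  have h : ∀ x : Omega1 →₀ ℝ, kNorm rho sigma (-x) ≤ kNorm rho sigma x := fun x => by
    simpa using kNorm_smul_le rho sigma (-1) x
  refine le_antisymm (h x) ?_
  simpa only [neg_neg] using h (-x)

theorem eq_zero_of_kNorm_eq_zero {rho : Omega1 → Omega1 → ℕ} {sigma : CodeSeq ℕ → ℕ}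
    {x : Omega1 →₀ ℝ} (hx : kNorm rho sigma x = 0) : x = 0 := by
  refine Finsupp.ext fun γ => ?_
  have h := abs_pairing_le_kNorm ((isNormingFamily_K rho sigma).basis γ) x
  rw [pairing_single] at h
  exact abs_eq_zero.1 (le_antisymm (h.trans hx.le) (abs_nonneg _))

/-- `c₀₀(ω₁)` with real scalars, to be normed by the norming set `K`. -/
def C00 (_rho : Omega1 → Omega1 → ℕ) (_sigma : CodeSeq ℕ → ℕ) : Type := Omega1 →₀ ℝ

noncomputable instance (rho : Omega1 → Omega1 → ℕ) (sigma : CodeSeq ℕ → ℕ) :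
    AddCommGroup (C00 rho sigma) :=
  inferInstanceAs (AddCommGroup (Omega1 →₀ ℝ))

noncomputable instance (rho : Omega1 → Omega1 → ℕ) (sigma : CodeSeq ℕ → ℕ) :
    Module ℝ (C00 rho sigma) :=
  inferInstanceAs (Module ℝ (Omega1 →₀ ℝ))

noncomputable instance instNormedAddCommGroupC00 (rho : Omega1 → Omega1 → ℕ)
    (sigma : CodeSeq ℕ → ℕ) : NormedAddCommGroup (C00 rho sigma) :=
  AddGroupNorm.toNormedAddCommGroup
    { toFun := fun x : Omega1 →₀ ℝ => kNorm rho sigma x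
      map_zero' := by
        refine le_antisymm (kNorm_le fun φ _ => ?_) (kNorm_nonneg rho sigma _)
        exact le_of_eq Finsupp.sum_zero_index
      add_le' := fun x y => kNorm_le fun φ hφ => by
        refine (pairing_add φ x y).le.trans ?_
        exact add_le_add (pairing_le_kNorm hφ x) (pairing_le_kNorm hφ y)
      neg' := kNorm_neg rho sigma
      eq_zero_of_map_eq_zero' := fun _ hx => eq_zero_of_kNorm_eq_zero hx }

noncomputable instance (rho : Omega1 → Omega1 → ℕ) (sigma : CodeSeq ℕ → ℕ) :
    NormedSpace ℝ (C00 rho sigma) where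
  norm_smul_le := fun a x => kNorm_smul_le rho sigma a x

/-- The Banach space `𝔛`: the completion of `c₀₀(ω₁)` under the norm induced by `K`. -/
abbrev SpaceX (rho : Omega1 → Omega1 → ℕ) (sigma : CodeSeq ℕ → ℕ) : Type :=
  UniformSpace.Completion (C00 rho sigma)

/-! ### Distortion -/

section Distortion

variable {E : Type*} [NormedAddCommGroup E] [NormedSpace ℝ E]

/-- `N` is an equivalent norm on `E` (in particular it vanishes only at `0`). -/
def IsEquivalentNorm (N : Seminorm ℝ E) : Prop :=
  ∃ c C : ℝ, 0 < c ∧ 0 < C ∧ ∀ x, c * ‖x‖ ≤ N x ∧ N x ≤ C * ‖x‖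

/-- The distortion `d(E, N) = inf_Y sup {N x / N y : x, y ∈ Y, ‖x‖ = ‖y‖ = 1}`, the infimum taken
over all infinite dimensional subspaces `Y`, as an element of `[0, ∞]`. -/
noncomputable def distortion (N : Seminorm ℝ E) : ℝ≥0∞ :=
  ⨅ (Y : Submodule ℝ E) (_ : ¬ FiniteDimensional ℝ Y),
    ⨆ (x : E) (_ : x ∈ Y ∧ ‖x‖ = 1) (y : E) (_ : y ∈ Y ∧ ‖y‖ = 1), ENNReal.ofReal (N x / N y)

end Distortion

end LongC0

/-!
The space `𝔛` contains an isomorphic copy of `c₀`, and a space containing `c₀` is not distortable.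

*A copy of `c₀`* (`exists_c0_embedding`). Take an increasing sequence `u` of ordinals. If on some
tail of `(e_{u i})` the norm is equivalent to the supremum norm, this tail spans `c₀`. Otherwise
there is a normalized block sequence `(b_k)` along `u` whose coordinates are as small as desired
compared with the values of `ϱ` on the coordinates preceding the block. The sums `∑ a_k b_k` are
then bounded by `4 max |a_k|`, which is proved by induction over the norming set: consider an
average `(1/m) ∑ φ_i` of a separated sequence, and the first block `b_n` at which two of the
`φ_i` have met the coordinates seen so far. On the blocks before `b_n` the average is `(1/m) φ_i` for a single
`i`, which contributes at most `4/m ≤ 2` times `max |a_k|`. On `b_n` it contributes at most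
`max |a_k|`. By separation the cardinality of its support is at most a value of `ϱ` at coordinates
up to `b_n`, so on all later blocks together it contributes at most `max |a_k|`. The lower estimate
comes from restricting functionals to the interval of one block.

*Distortion* (`distortion_eq_one_of_c0`). By James' argument (`exists_block_almost_isometric`),
a norm equivalent to the supremum norm is nearly a multiple of it on the span of some isometric
block sequence. Doing this for the norm of `𝔛` and then for the given norm yields a subspace on
which these two norms are nearly proportional.
-/

namespace LongC0

open scoped NNReal ENNReal

/-! ### The supremum norm on `c₀₀(ℕ)` and block sequences -/

/-- The supremum norm on `c₀₀(ℕ)`. -/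
noncomputable def supNorm (a : ℕ →₀ ℝ) : ℝ := ((a.support.sup fun i => ‖a i‖₊ : ℝ≥0) : ℝ)

theorem supNorm_nonneg (a : ℕ →₀ ℝ) : 0 ≤ supNorm a := NNReal.coe_nonneg _

theorem abs_le_supNorm (a : ℕ →₀ ℝ) (i : ℕ) : |a i| ≤ supNorm a := by
  by_cases h : a i = 0
  · simpa [h] using supNorm_nonneg a
  · have := Finset.le_sup (f := fun i => ‖a i‖₊) (Finsupp.mem_support_iff.2 h)
    exact_mod_cast this

theorem supNorm_le {a : ℕ →₀ ℝ} {r : ℝ} (hr : 0 ≤ r) (h : ∀ i, |a i| ≤ r) : supNorm a ≤ r := by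
  lift r to ℝ≥0 using hr
  refine NNReal.coe_le_coe.2 (Finset.sup_le fun i _ => ?_)
  exact_mod_cast h i

theorem exists_abs_eq_supNorm (a : ℕ →₀ ℝ) : ∃ i, |a i| = supNorm a := by
  by_cases h : a = 0
  · exact ⟨0, by simp [h, supNorm]⟩
  · obtain ⟨i, -, hi⟩ := Finset.exists_mem_eq_sup a.support (Finsupp.support_nonempty_iff.2 h)
      fun i => ‖a i‖₊
    exact ⟨i, by simp [supNorm, hi]⟩

theorem supNorm_smul (r : ℝ) (a : ℕ →₀ ℝ) : supNorm (r • a) = |r| * supNorm a := by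
  refine le_antisymm (supNorm_le (by positivity [supNorm_nonneg a]) fun i => ?_) ?_
  · simpa [abs_mul] using mul_le_mul_of_nonneg_left (abs_le_supNorm a i) (abs_nonneg r)
  · obtain ⟨i, hi⟩ := exists_abs_eq_supNorm a
    rw [← hi]
    simpa [abs_mul] using abs_le_supNorm (r • a) i

theorem supNorm_single (i : ℕ) : supNorm (Finsupp.single i 1) = 1 := by
  refine le_antisymm (supNorm_le zero_le_one fun j => ?_) ?_
  · by_cases h : i = j <;> simp [h]
  · simpa using abs_le_supNorm (Finsupp.single i 1) i

/-- The support of `b k` is contained in `[N k, N (k + 1))`, and `N` is strictly increasing. -/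
structure IsBlockIn (N : ℕ → ℕ) (b : ℕ → ℕ →₀ ℝ) : Prop where
  strictMono : StrictMono N
  mem_Ico : ∀ k i, b k i ≠ 0 → N k ≤ i ∧ i < N (k + 1)

/-- If vectors with a property can be found arbitrarily far out, then a block sequence of such
vectors exists; the property may depend on the starting point of the block. -/
theorem exists_isBlockIn {Q : ℕ → (ℕ →₀ ℝ) → Prop}
    (h : ∀ n, ∃ x : ℕ →₀ ℝ, (∀ i, x i ≠ 0 → n ≤ i) ∧ Q n x) (n : ℕ) :
    ∃ (N : ℕ → ℕ) (b : ℕ → ℕ →₀ ℝ), IsBlockIn N b ∧ N 0 = n ∧ ∀ k, Q (N k) (b k) := by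
  choose x hx hQ using h
  let e : ℕ → ℕ := fun n => (n + 1) ⊔ ((x n).support.sup id + 1)
  refine ⟨fun k => e^[k] n, fun k => x (e^[k] n), ⟨strictMono_nat_of_lt_succ fun k => ?_, ?_⟩,
    rfl, fun k => hQ _⟩
  · rw [Function.iterate_succ_apply']
    exact (Nat.lt_succ_self _).trans_le le_sup_left
  · intro k i hi
    refine ⟨hx _ i hi, ?_⟩
    rw [Function.iterate_succ_apply']
    refine lt_of_lt_of_le (Nat.lt_succ_of_le ?_) le_sup_right
    exact Finset.le_sup (f := id) (Finsupp.mem_support_iff.2 hi)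

/-- The linear map `a ↦ ∑ k, a k • b k`. -/
noncomputable abbrev blockMap (b : ℕ → ℕ →₀ ℝ) : (ℕ →₀ ℝ) →ₗ[ℝ] (ℕ →₀ ℝ) :=
  Finsupp.linearCombination ℝ b

namespace IsBlockIn

variable {N : ℕ → ℕ} {b : ℕ → ℕ →₀ ℝ}

theorem eq_of_ne_zero (hb : IsBlockIn N b) {k l i : ℕ} (hk : b k i ≠ 0) (hl : b l i ≠ 0) :
    k = l := by
  have h1 := hb.mem_Ico k i hk
  have h2 := hb.mem_Ico l i hl
  have h3 : k < l + 1 := hb.strictMono.lt_iff_lt.1 (h1.1.trans_lt h2.2)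
  have h4 : l < k + 1 := hb.strictMono.lt_iff_lt.1 (h2.1.trans_lt h1.2)
  omega

theorem blockMap_apply (hb : IsBlockIn N b) (a : ℕ →₀ ℝ) {k i : ℕ} (hk : b k i ≠ 0) :
    blockMap b a i = a k * b k i := by
  rw [Finsupp.linearCombination_apply, Finsupp.sum, Finsupp.finsetSum_apply,
    Finset.sum_eq_single k]
  · simp
  · intro l _ hl
    have : b l i = 0 := by
      by_contra h
      exact hl (hb.eq_of_ne_zero h hk)
    simp [this]
  · intro h
    simp [Finsupp.notMem_support_iff.1 h]

theorem exists_ne_zero (a : ℕ →₀ ℝ) {i : ℕ} (hi : blockMap b a i ≠ 0) : ∃ k, b k i ≠ 0 := by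
  by_contra! h
  refine hi ?_
  rw [Finsupp.linearCombination_apply, Finsupp.sum, Finsupp.finsetSum_apply]
  exact Finset.sum_eq_zero fun k _ => by simp [h k]

theorem le_of_ne_zero (hb : IsBlockIn N b) (a : ℕ →₀ ℝ) {i : ℕ} (hi : blockMap b a i ≠ 0) :
    N 0 ≤ i := by
  obtain ⟨k, hk⟩ := exists_ne_zero a hi
  exact (hb.strictMono.monotone (Nat.zero_le k)).trans (hb.mem_Ico k i hk).1

theorem supNorm_blockMap (hb : IsBlockIn N b) (h1 : ∀ k, supNorm (b k) = 1) (a : ℕ →₀ ℝ) :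
    supNorm (blockMap b a) = supNorm a := by
  refine le_antisymm (supNorm_le (supNorm_nonneg a) fun i => ?_) ?_
  · by_cases hi : blockMap b a i = 0
    · simpa [hi] using supNorm_nonneg a
    · obtain ⟨k, hk⟩ := exists_ne_zero a hi
      rw [hb.blockMap_apply a hk, abs_mul]
      calc |a k| * |b k i| ≤ supNorm a * 1 :=
            mul_le_mul (abs_le_supNorm a k) (h1 k ▸ abs_le_supNorm (b k) i) (abs_nonneg _)
              (supNorm_nonneg a)
        _ = supNorm a := mul_one _
  · obtain ⟨k, hk⟩ := exists_abs_eq_supNorm a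
    obtain ⟨i, hi⟩ := exists_abs_eq_supNorm (b k)
    rw [h1] at hi
    have hne : b k i ≠ 0 := by
      intro h
      simp [h] at hi
    have := abs_le_supNorm (blockMap b a) i
    rwa [hb.blockMap_apply a hne, abs_mul, hi, mul_one, hk] at this

end IsBlockIn

/-! ### Non-distortability of `c₀` -/

/-- A seminorm equivalent to the supremum norm is, on the span of some block sequence which is
isometrically the unit vector basis of `c₀`, nearly a multiple of the supremum norm (James). -/
theorem exists_block_almost_isometric (p : Seminorm ℝ (ℕ →₀ ℝ)) {c C : ℝ} (hc : 0 < c)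
    (hlow : ∀ x, c * supNorm x ≤ p x) (hup : ∀ x, p x ≤ C * supNorm x) {ε : ℝ} (hε : 0 < ε) :
    ∃ T : (ℕ →₀ ℝ) →ₗ[ℝ] (ℕ →₀ ℝ), (∀ x, supNorm (T x) = supNorm x) ∧ ∃ A : ℝ, 0 < A ∧
      ∀ x, A * (1 - ε) * supNorm x ≤ p (T x) ∧ p (T x) ≤ A * (1 + ε) * supNorm x := by
  -- `A` is the asymptotic supremum of `p` over the unit ball of the tails of `c₀₀(ℕ)`.
  let S : Set ℝ := {t | ∃ n, ∀ x : ℕ →₀ ℝ, (∀ i, x i ≠ 0 → n ≤ i) → p x ≤ t * supNorm x}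
  have hSc : ∀ t ∈ S, c ≤ t := by
    rintro t ⟨n, hn⟩
    have h := hn (Finsupp.single n 1) fun i hi => by
      by_contra h
      exact hi (by rw [Finsupp.single_apply, if_neg (by omega)])
    have h' := hlow (Finsupp.single n 1)
    rw [supNorm_single] at h h'
    linarith
  have hSne : S.Nonempty := ⟨C, 0, fun x _ => hup x⟩
  have hSb : BddBelow S := ⟨c, hSc⟩
  set A := sInf S with hA
  have hApos : 0 < A := hc.trans_le (le_csInf hSne hSc)
  have hδ : 0 < ε / 3 := by positivity
  obtain ⟨t, ⟨n, hn⟩, htA⟩ := exists_lt_of_csInf_lt hSne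
    (show sInf S < A * (1 + ε / 3) by rw [← hA]; nlinarith)
  have hfar : ∀ k, ∃ x : ℕ →₀ ℝ, (∀ i, x i ≠ 0 → k ≤ i) ∧
      (supNorm x = 1 ∧ A * (1 - ε / 3) ≤ p x) := by
    intro k
    have hnot : A * (1 - ε / 3) ∉ S := fun h => by
      have := csInf_le hSb h
      rw [← hA] at this
      nlinarith
    simp only [S, Set.mem_ofPred_eq, not_exists, not_forall, not_le] at hnot
    obtain ⟨x, hx, hlt⟩ := hnot k
    have hpos : 0 < supNorm x := by
      refine lt_of_le_of_ne (supNorm_nonneg x) fun h => ?_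
      have := hup x
      rw [← h] at this hlt
      linarith
    refine ⟨(supNorm x)⁻¹ • x, fun i hi => hx i fun h => hi (by simp [h]), ?_, ?_⟩
    · rw [supNorm_smul, abs_of_pos (inv_pos.2 hpos), inv_mul_cancel₀ hpos.ne']
    · rw [map_smul_eq_mul, Real.norm_eq_abs, abs_of_pos (inv_pos.2 hpos), inv_mul_eq_div,
        le_div_iff₀ hpos]
      exact hlt.le
  obtain ⟨N, b, hb, hN, hQ⟩ := exists_isBlockIn hfar n
  have hupT : ∀ x, p (blockMap b x) ≤ A * (1 + ε / 3) * supNorm x := fun x => by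
    refine (hn _ fun i hi => hN ▸ hb.le_of_ne_zero x hi).trans ?_
    rw [hb.supNorm_blockMap (fun k => (hQ k).1)]
    exact mul_le_mul_of_nonneg_right htA.le (supNorm_nonneg x)
  refine ⟨blockMap b, hb.supNorm_blockMap fun k => (hQ k).1, A, hApos, fun x => ⟨?_, ?_⟩⟩
  · obtain ⟨k, hk⟩ := exists_abs_eq_supNorm x
    -- Reflecting all coordinates but the largest one preserves the supremum norm, and the sum
    -- of a vector and its reflection is `2 (x k) e_k`.
    set y := Finsupp.single k (2 * x k) - x with hy
    have hyn : supNorm y ≤ supNorm x := supNorm_le (supNorm_nonneg x) fun i => by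
      by_cases h : k = i
      · subst h
        have : y k = x k := by simp [hy]; ring
        rw [this]
        exact abs_le_supNorm x k
      · have : y i = -x i := by simp [hy, h]
        rw [this, abs_neg]
        exact abs_le_supNorm x i
    have hsum : blockMap b x + blockMap b y = (2 * x k) • b k := by
      rw [← map_add, hy, add_sub_cancel, Finsupp.linearCombination_single]
    have h1 : p ((2 * x k) • b k) ≤ p (blockMap b x) + p (blockMap b y) :=
      hsum ▸ map_add_le_add p _ _
    rw [map_smul_eq_mul, Real.norm_eq_abs, abs_mul, abs_two, hk] at h1
    have h2 : 2 * supNorm x * (A * (1 - ε / 3)) ≤ 2 * supNorm x * p (b k) :=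
      mul_le_mul_of_nonneg_left (hQ k).2 (by linarith [supNorm_nonneg x])
    have h3 : A * (1 + ε / 3) * supNorm y ≤ A * (1 + ε / 3) * supNorm x :=
      mul_le_mul_of_nonneg_left hyn (by positivity)
    linarith [hupT y]
  · refine (hupT x).trans (mul_le_mul_of_nonneg_right ?_ (supNorm_nonneg x))
    exact mul_le_mul_of_nonneg_left (by linarith) hApos.le

/-! ### Distortion of spaces containing `c₀` -/

section Distortion

variable {E : Type*} [NormedAddCommGroup E] [NormedSpace ℝ E]

theorem one_le_distortion {N : Seminorm ℝ E} (hN : IsEquivalentNorm N) : 1 ≤ distortion N := by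
  obtain ⟨c, C, hc, -, h⟩ := hN
  refine le_iInf₂ fun Y hY => ?_
  have : ∃ x ∈ Y, x ≠ 0 := by
    by_contra! h0
    have : Y = ⊥ := (Submodule.eq_bot_iff Y).2 h0
    subst this
    exact hY inferInstance
  obtain ⟨x, hx, hx0⟩ := this
  have hx1 : ‖(‖x‖⁻¹ : ℝ) • x‖ = 1 := norm_smul_inv_norm (𝕜 := ℝ) hx0
  have hmem : (‖x‖⁻¹ : ℝ) • x ∈ Y ∧ ‖(‖x‖⁻¹ : ℝ) • x‖ = 1 := ⟨Y.smul_mem _ hx, hx1⟩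
  refine le_trans ?_ (le_iSup₂_of_le _ hmem (le_iSup₂_of_le _ hmem le_rfl))
  have hpos : 0 < N ((‖x‖⁻¹ : ℝ) • x) := by
    have := (h ((‖x‖⁻¹ : ℝ) • x)).1
    rw [hx1] at this
    linarith
  rw [div_self hpos.ne', ENNReal.ofReal_one]

/-- No equivalent norm distorts a space containing an isomorphic copy of `c₀₀(ℕ)` with the supremum
norm: on a further copy both norms are nearly multiples of the supremum norm. -/
theorem distortion_eq_one_of_c0 {N : Seminorm ℝ E} (hN : IsEquivalentNorm N)
    (L : (ℕ →₀ ℝ) →ₗ[ℝ] E) {c C : ℝ} (hc : 0 < c) (hlow : ∀ a, c * supNorm a ≤ ‖L a‖)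
    (hup : ∀ a, ‖L a‖ ≤ C * supNorm a) : distortion N = 1 := by
  refine le_antisymm ?_ (one_le_distortion hN)
  obtain ⟨c', C', hc', hC', hN'⟩ := hN
  have key : ∀ ε : ℝ, 0 < ε → ε < 1 →
      distortion N ≤ ENNReal.ofReal (((1 + ε) / (1 - ε)) ^ 2) := by
    intro ε hε hε1
    obtain ⟨T, hT, A, hA, hTA⟩ := exists_block_almost_isometric
      ((normSeminorm ℝ E).comp L) hc hlow hup hε
    obtain ⟨S, hS, B, hB, hSB⟩ := exists_block_almost_isometric (N.comp (L.comp T))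
      (mul_pos hc' hc)
      (fun x => by
        have h1 := (hN' (L (T x))).1
        have h2 := mul_le_mul_of_nonneg_left (hlow (T x)) hc'.le
        rw [hT] at h2
        rw [mul_assoc]
        exact h2.trans h1)
      (C := C' * C)
      (fun x => by
        have h1 := (hN' (L (T x))).2
        have h2 := mul_le_mul_of_nonneg_left (hup (T x)) hC'.le
        rw [hT] at h2
        rw [mul_assoc]
        exact h1.trans h2) hε
    let J : (ℕ →₀ ℝ) →ₗ[ℝ] E := L.comp (T.comp S)
    have hJ1 : ∀ a, A * (1 - ε) * supNorm a ≤ ‖J a‖ ∧ ‖J a‖ ≤ A * (1 + ε) * supNorm a :=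
      fun a => by
        have := hTA (S a)
        rw [hS] at this
        exact this
    have hJ2 : ∀ a, B * (1 - ε) * supNorm a ≤ N (J a) ∧ N (J a) ≤ B * (1 + ε) * supNorm a :=
      hSB
    have hinj : Function.Injective J := by
      refine (injective_iff_map_eq_zero J).2 fun a ha => ?_
      have h := (hJ1 a).1
      rw [ha, norm_zero] at h
      have h0 : supNorm a ≤ 0 := by
        by_contra! h0
        have : 0 < A * (1 - ε) * supNorm a := mul_pos (mul_pos hA (by linarith)) h0
        linarith
      exact Finsupp.ext fun i => abs_eq_zero.1
        (le_antisymm ((abs_le_supNorm a i).trans h0) (abs_nonneg _))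
    have hinf : ¬ FiniteDimensional ℝ (LinearMap.range J) := by
      intro hfin
      have : FiniteDimensional ℝ (ℕ →₀ ℝ) :=
        LinearEquiv.finiteDimensional (LinearEquiv.ofInjective J hinj).symm
      have hli : LinearIndependent ℝ fun i : ℕ => (Finsupp.single i 1 : ℕ →₀ ℝ) :=
        Finsupp.linearIndependent_single_one ℝ ℕ
      exact not_finite_iff_infinite.2 inferInstance hli.finite
    refine iInf₂_le_of_le _ hinf (iSup₂_le ?_)
    rintro _ ⟨⟨a, rfl⟩, ha⟩
    refine iSup₂_le ?_
    rintro _ ⟨⟨b, rfl⟩, hb⟩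
    refine ENNReal.ofReal_le_ofReal ?_
    have ha1 := (hJ1 a).1
    have hb1 := (hJ1 b).2
    rw [ha] at ha1
    rw [hb] at hb1
    have ha2 := (hJ2 a).2
    have hb2 := (hJ2 b).1
    have h1 : 0 < 1 - ε := by linarith
    have hb0 : 0 < supNorm b := by
      by_contra! h
      have : A * (1 + ε) * supNorm b ≤ 0 := mul_nonpos_of_nonneg_of_nonpos (by positivity) h
      linarith
    have hNb : 0 < N (J b) := lt_of_lt_of_le (by positivity) hb2
    -- `supNorm a ≤ (1 + ε) / (1 - ε) * supNorm b`, since the images of both have norm one.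
    have hab : supNorm a * (1 - ε) ≤ supNorm b * (1 + ε) := by
      have : A * (supNorm a * (1 - ε)) ≤ A * (supNorm b * (1 + ε)) := by linarith
      exact le_of_mul_le_mul_left this hA
    rw [div_le_iff₀ hNb, div_pow, div_mul_eq_mul_div, le_div_iff₀ (by positivity)]
    calc N (J a) * (1 - ε) ^ 2 ≤ B * (1 + ε) * supNorm a * (1 - ε) ^ 2 := by gcongr
      _ = B * (1 + ε) * (1 - ε) * (supNorm a * (1 - ε)) := by ring
      _ ≤ B * (1 + ε) * (1 - ε) * (supNorm b * (1 + ε)) := by gcongr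
      _ = (1 + ε) ^ 2 * (B * (1 - ε) * supNorm b) := by ring
      _ ≤ (1 + ε) ^ 2 * N (J b) := by gcongr
  have hlim : Filter.Tendsto (fun ε : ℝ => ENNReal.ofReal (((1 + ε) / (1 - ε)) ^ 2))
      (nhdsWithin 0 (Set.Ioi 0)) (nhds 1) := by
    have : ContinuousAt (fun ε : ℝ => ENNReal.ofReal (((1 + ε) / (1 - ε)) ^ 2)) 0 := by
      refine ENNReal.continuous_ofReal.continuousAt.comp ?_
      exact ((continuousAt_const.add continuousAt_id).div
        (continuousAt_const.sub continuousAt_id) (by simp)).pow 2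
    have h := this.tendsto
    simp only [add_zero, sub_zero, div_one, one_pow, ENNReal.ofReal_one] at h
    exact h.mono_left nhdsWithin_le_nhds
  refine ge_of_tendsto hlim ?_
  filter_upwards [Ioo_mem_nhdsGT (zero_lt_one' ℝ)] with ε hε using key ε hε.1 hε.2

end Distortion

/-! ### Vectors along an increasing sequence of ordinals -/

theorem exists_strictMono_nat : ∃ u : ℕ → Omega1, StrictMono u := by
  have h : ∀ k : ℕ, (k : Ordinal.{0}) < Ordinal.omega 1 := fun k =>
    (Ordinal.natCast_lt_omega0 k).trans Ordinal.omega0_lt_omega_one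
  exact ⟨fun k => Ordinal.ToType.mk ⟨k, h k⟩, fun i j hij =>
    Ordinal.ToType.mk.lt_iff_lt.2 (Subtype.mk_lt_mk.2 (Nat.cast_lt.2 hij))⟩

/-- The linear functional on `c₀₀(ω₁)` induced by `φ`. -/
noncomputable def pairingLinear (φ : Omega1 →₀ ℚ) : (Omega1 →₀ ℝ) →ₗ[ℝ] ℝ where
  toFun := pairing φ
  map_add' := pairing_add φ
  map_smul' a x := by simp [pairing_smul]

/-- The value of `φ` at the copy of `a : ℕ →₀ ℝ` along `u : ℕ → ω₁`. -/
noncomputable def pull (u : ℕ → Omega1) (φ : Omega1 →₀ ℚ) : (ℕ →₀ ℝ) →ₗ[ℝ] ℝ :=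
  (pairingLinear φ).comp (Finsupp.lmapDomain ℝ ℝ u)

theorem pull_apply (u : ℕ → Omega1) (φ : Omega1 →₀ ℚ) (a : ℕ →₀ ℝ) :
    pull u φ a = a.sum fun t r => (φ (u t) : ℝ) * r := by
  change (Finsupp.mapDomain u a).sum (fun α r => (φ α : ℝ) * r) = _
  exact Finsupp.sum_mapDomain_index (by simp) (by intros; ring)

theorem pull_congr {u : ℕ → Omega1} {φ ψ : Omega1 →₀ ℚ} {a : ℕ →₀ ℝ} {r : ℚ}
    (h : ∀ t, a t ≠ 0 → φ (u t) = r * ψ (u t)) : pull u φ a = r * pull u ψ a := by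
  rw [pull_apply, pull_apply, Finsupp.mul_sum]
  refine Finsupp.sum_congr fun t ht => ?_
  rw [h t (Finsupp.mem_support_iff.1 ht)]
  push_cast
  ring

theorem pull_blockMap (u : ℕ → Omega1) (φ : Omega1 →₀ ℚ) (b : ℕ → ℕ →₀ ℝ) (a : ℕ →₀ ℝ) :
    pull u φ (blockMap b a) = a.sum fun k r => r * pull u φ (b k) := by
  rw [Finsupp.linearCombination_apply, map_finsuppSum]
  simp

theorem supNorm_le_kNorm {rho : Omega1 → Omega1 → ℕ} {sigma : CodeSeq ℕ → ℕ} {u : ℕ → Omega1}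
    (hu : StrictMono u) (a : ℕ →₀ ℝ) : supNorm a ≤ kNorm rho sigma (Finsupp.mapDomain u a) := by
  refine supNorm_le (kNorm_nonneg _ _ _) fun i => ?_
  have h := abs_pairing_le_kNorm ((isNormingFamily_K rho sigma).basis (u i))
    (Finsupp.mapDomain u a)
  rwa [pairing_single, Finsupp.mapDomain_apply hu.injective] at h

/-! ### Flat block sequences -/

/-- The largest value of `ϱ` at the pairs `(u i, u j)` with `i, j < N`. -/
def rhoMax (rho : Omega1 → Omega1 → ℕ) (u : ℕ → Omega1) (N : ℕ) : ℕ :=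
  (Finset.range N ×ˢ Finset.range N).sup fun x => rho (u x.1) (u x.2)

theorem le_rhoMax (rho : Omega1 → Omega1 → ℕ) (u : ℕ → Omega1) {N i j : ℕ} (hi : i < N)
    (hj : j < N) : rho (u i) (u j) ≤ rhoMax rho u N :=
  Finset.le_sup (f := fun x : ℕ × ℕ => rho (u x.1) (u x.2)) (b := (i, j)) (by simp [hi, hj])

theorem two_le_m {j : ℕ} (hj : 1 ≤ j) : 2 ≤ m j := by
  induction j, hj using Nat.le_induction with
  | base => simp [m]
  | succ j hj ih =>
    obtain ⟨i, rfl⟩ := Nat.exists_eq_add_of_le' hj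
    exact ih.trans (Nat.le_self_pow (by norm_num) _)

/-- A normalized block sequence along `u` that is so flat that `ϱ` on the coordinates before a block
is negligible against the inverse of the largest coordinate of the block. -/
structure IsFlatBlock (rho : Omega1 → Omega1 → ℕ) (sigma : CodeSeq ℕ → ℕ) (u : ℕ → Omega1)
    (N : ℕ → ℕ) (b : ℕ → ℕ →₀ ℝ) : Prop where
  block : IsBlockIn N b
  norm : ∀ k, kNorm rho sigma (Finsupp.mapDomain u (b k)) = 1
  flat : ∀ k, rhoMax rho u (N k) * supNorm (b k) ≤ (1 / 2) ^ (k + 1)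

section Flat

variable {rho : Omega1 → Omega1 → ℕ} {sigma : CodeSeq ℕ → ℕ} {u : ℕ → Omega1}
  {N : ℕ → ℕ} {b : ℕ → ℕ →₀ ℝ}

open Classical in
/-- `f` is bounded by `4` times the supremum norm of the coefficients, together with all its
restrictions to intervals, on the linear combinations of the vectors `b k`. -/
def IsBoundedOn (u : ℕ → Omega1) (b : ℕ → ℕ →₀ ℝ) (f : Omega1 →₀ ℚ) : Prop :=
  ∀ I : Set Omega1, I.OrdConnected → ∀ (s : ℝ) (c : ℕ → ℝ), (∀ k, |c k| ≤ s) → ∀ n,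
    |∑ k ∈ Finset.range n, c k * pull u (f.filter (· ∈ I)) (b k)| ≤ 4 * s

theorem abs_pull_le_card_mul (hu : StrictMono u) {f : Omega1 →₀ ℚ} (hf : f ∈ K rho sigma)
    (a : ℕ →₀ ℝ) : |pull u f a| ≤ f.support.card * supNorm a := by
  classical
  rw [pull_apply, Finsupp.sum]
  have hsub : a.support.filter (fun t => f (u t) ≠ 0) ⊆
      a.support := Finset.filter_subset _ _
  rw [← Finset.sum_subset hsub]
  · refine (Finset.abs_sum_le_sum_abs _ _).trans ?_
    refine (Finset.sum_le_card_nsmul _ _ (supNorm a) fun t _ => ?_).trans ?_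
    · rw [abs_mul]
      have h : |(f (u t) : ℝ)| ≤ 1 := by exact_mod_cast abs_le_one_of_mem_K hf (u t)
      calc |(f (u t) : ℝ)| * |a t| ≤ 1 * supNorm a :=
            mul_le_mul h (abs_le_supNorm a t) (abs_nonneg _) zero_le_one
        _ = supNorm a := one_mul _
    · rw [nsmul_eq_mul]
      refine mul_le_mul_of_nonneg_right ?_ (supNorm_nonneg a)
      exact_mod_cast Finset.card_le_card_of_injOn u (fun t ht => by simpa using
        (Finset.mem_filter.1 ht).2) hu.injective.injOn
  · intro t ht ht'
    have : f (u t) = 0 := by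
      by_contra h
      exact ht' (Finset.mem_filter.2 ⟨ht, h⟩)
    simp [this]

theorem support_weighted_subset [DecidableEq Omega1] (i d : ℕ) (φ : ℕ → Omega1 →₀ ℚ) :
    (weighted i d φ).support ⊆ (Finset.range d).biUnion fun l => (φ l).support :=
  Finsupp.support_smul.trans Finsupp.support_finsetSum

theorem weighted_apply (i d : ℕ) (φ : ℕ → Omega1 →₀ ℚ) (α : Omega1) :
    weighted i d φ α = (1 / (m i : ℚ)) * ∑ k ∈ Finset.range d, φ k α := by
  simp [weighted]

/-- The inductive step for averages. Before two terms of a separated sequence have met the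
coordinates of the first blocks, the average is a single term divided by its weight; afterwards
the number of its coordinates is so small that it is negligible on all later blocks. -/
theorem IsFlatBlock.isBoundedOn_weighted (hb : IsFlatBlock rho sigma u N b) (hu : StrictMono u)
    {j d : ℕ} (hj : 1 ≤ j) {φ : ℕ → Omega1 →₀ ℚ} (hφ : ∀ i < d, IsBoundedOn u b (φ i))
    (hsep : IsSeparatedBlock rho d φ) (hK : weighted j d φ ∈ K rho sigma) :
    IsBoundedOn u b (weighted j d φ) := by
  classical
  intro I hI s c hc n
  have hs : 0 ≤ s := (abs_nonneg _).trans (hc 0)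
  have hm : (2 : ℝ) ≤ m j := by exact_mod_cast two_le_m hj
  set g := (weighted j d φ).filter (· ∈ I) with hg
  have hgK : g ∈ K rho sigma := by
    convert (isNormingFamily_K rho sigma).interval _ hK I hI
  have hone : ∀ k, |pull u g (b k)| ≤ 1 := fun k => by
    rw [← hb.norm k]
    exact abs_pairing_le_kNorm hgK _
  have hterm : ∀ k, ∀ r : ℝ, |pull u g (b k)| ≤ r → |c k * pull u g (b k)| ≤ s * r := by
    intro k r hr
    rw [abs_mul]
    exact mul_le_mul (hc k) hr (abs_nonneg _) hs
  have main : ∀ n, |∑ k ∈ Finset.range n, c k * pull u g (b k)| ≤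
      (4 - (1 / 2) ^ n) * s := by
    intro n
    induction n with
    | zero => simpa using by linarith
    | succ n ih =>
      rw [Finset.sum_range_succ]
      refine (abs_add_le _ _).trans ?_
      by_cases hP : ∃ i k, i < k ∧ k < d ∧ (∃ t < N n, φ i (u t) ≠ 0) ∧ ∃ t < N n, φ k (u t) ≠ 0
      · obtain ⟨i, k, hik, hk, ⟨t, ht, hti⟩, t', ht', htk⟩ := hP
        have hcard : g.support.card ≤ rhoMax rho u (N n) := by
          refine le_trans (Finset.card_le_card ?_) ((hsep.2 i k hik hk (u t) (by simpa using hti)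
            (u t') (by simpa using htk)).trans (le_rhoMax rho u ht ht'))
          refine Finset.Subset.trans ?_ (by convert support_weighted_subset j d φ)
          rw [hg, Finsupp.support_filter]
          exact Finset.filter_subset _ _
        have h1 : |pull u g (b n)| ≤ (1 / 2) ^ (n + 1) := by
          refine (abs_pull_le_card_mul hu hgK _).trans (le_trans ?_ (hb.flat n))
          exact mul_le_mul_of_nonneg_right (by exact_mod_cast hcard) (supNorm_nonneg _)
        have h2 := hterm n _ h1
        have h3 : ((1 : ℝ) / 2) ^ n = 2 * (1 / 2) ^ (n + 1) := by ring
        rw [h3] at ih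
        linarith
      · have h1 := hterm n 1 (hone n)
        have h2 : |∑ k ∈ Finset.range n, c k * pull u g (b k)| ≤ 2 * s := by
          by_cases hQ : ∃ i < d, ∃ t < N n, φ i (u t) ≠ 0
          · obtain ⟨i, hi, hit⟩ := hQ
            have hsingle : ∀ k ∈ Finset.range n, c k * pull u g (b k) =
                ((1 / (m j : ℚ) : ℚ) : ℝ) *
                  (c k * pull u ((φ i).filter (· ∈ I)) (b k)) := by
              intro k hk
              rw [pull_congr (ψ := (φ i).filter (· ∈ I)) (r := 1 / (m j : ℚ))]
              · ring
              intro t ht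
              have htN : t < N n := (hb.block.mem_Ico k t ht).2.trans_le
                (hb.block.strictMono.monotone (Finset.mem_range.1 hk))
              by_cases htI : u t ∈ I
              · rw [hg, Finsupp.filter_apply_pos _ _ htI, Finsupp.filter_apply_pos _ _ htI,
                  weighted_apply, Finset.sum_eq_single_of_mem i (Finset.mem_range.2 hi)]
                intro l hl hli
                by_contra hne
                have hl := Finset.mem_range.1 hl
                rcases lt_or_gt_of_ne hli with h | h
                · exact hP ⟨l, i, h, hi, ⟨t, htN, hne⟩, hit⟩
                · exact hP ⟨i, l, h, hl, hit, ⟨t, htN, hne⟩⟩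
              · rw [hg, Finsupp.filter_apply_neg _ _ htI, Finsupp.filter_apply_neg _ _ htI,
                  mul_zero]
            rw [Finset.sum_congr rfl hsingle, ← Finset.mul_sum, abs_mul]
            have h4 := hφ i hi I hI s c hc n
            have h5 : |((1 / (m j : ℚ) : ℚ) : ℝ)| ≤ 1 / 2 := by
              push_cast
              rw [abs_of_nonneg (by positivity)]
              exact one_div_le_one_div_of_le two_pos hm
            calc _ ≤ 1 / 2 * (4 * s) := by
                  refine mul_le_mul h5 ?_ (abs_nonneg _) (by norm_num)
                  convert h4
              _ = 2 * s := by ring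
          · rw [Finset.sum_eq_zero]
            · simpa using hs
            intro k hk
            rw [pull_congr (ψ := g) (r := 0)]
            · simp
            intro t ht
            have htN : t < N n := (hb.block.mem_Ico k t ht).2.trans_le
              (hb.block.strictMono.monotone (Finset.mem_range.1 hk))
            rw [zero_mul]
            by_cases htI : u t ∈ I
            · rw [hg, Finsupp.filter_apply_pos _ _ htI, weighted_apply, Finset.sum_eq_zero,
                mul_zero]
              intro l hl
              by_contra hne
              exact hQ ⟨l, Finset.mem_range.1 hl, t, htN, hne⟩
            · rw [hg, Finsupp.filter_apply_neg _ _ htI]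
        have h3 : ((1 : ℝ) / 2) ^ (n + 1) * s ≤ 1 * s :=
          mul_le_mul_of_nonneg_right (pow_le_one₀ (by norm_num) (by norm_num)) hs
        linarith
  have h0 : 0 ≤ (1 / 2 : ℝ) ^ n * s := by positivity
  have := main n
  simp only [hg] at this ⊢
  convert this.trans (by linarith : (4 - (1 / 2 : ℝ) ^ n) * s ≤ 4 * s)

theorem IsFlatBlock.isBoundedOn_single (hb : IsFlatBlock rho sigma u N b) (hu : StrictMono u)
    (γ : Omega1) : IsBoundedOn u b (Finsupp.single γ 1) := by
  classical
  intro I hI s c hc n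
  have hs : 0 ≤ s := (abs_nonneg _).trans (hc 0)
  set g := (Finsupp.single γ (1 : ℚ)).filter (· ∈ I) with hg
  have hgK : g ∈ K rho sigma := (isNormingFamily_K rho sigma).interval _
    ((isNormingFamily_K rho sigma).basis γ) I hI
  have hterm : ∀ k, |c k * pull u g (b k)| ≤ s := fun k => by
    rw [abs_mul, ← mul_one s]
    refine mul_le_mul (hc k) ?_ (abs_nonneg _) hs
    rw [← hb.norm k]
    exact abs_pairing_le_kNorm hgK _
  have hzero : ∀ k, (∀ t, b k t ≠ 0 → u t ≠ γ) → c k * pull u g (b k) = 0 := fun k hk => by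
    rw [pull_congr (ψ := g) (r := 0)]
    · simp
    intro t ht
    by_cases htI : u t ∈ I <;> simp [hg, htI, hk t ht]
  have main : |∑ k ∈ Finset.range n, c k * pull u g (b k)| ≤ s := by
    by_cases h : ∃ k ∈ Finset.range n, ∃ t, b k t ≠ 0 ∧ u t = γ
    · obtain ⟨k, hk, t, ht, rfl⟩ := h
      rw [Finset.sum_eq_single_of_mem k hk]
      · exact hterm k
      · refine fun l _ hl => hzero l fun t' ht' htt => hl ?_
        rw [hu.injective htt] at ht'
        exact hb.block.eq_of_ne_zero ht' ht
    · push Not at h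
      rw [Finset.sum_eq_zero fun k hk => hzero k (h k hk), abs_zero]
      exact hs
  convert main.trans (by linarith : s ≤ 4 * s)

theorem IsFlatBlock.isBoundedOn (hb : IsFlatBlock rho sigma u N b) (hu : StrictMono u)
    {f : Omega1 →₀ ℚ} (hf : f ∈ K rho sigma) : IsBoundedOn u b f := by
  classical
  have hK := isNormingFamily_K rho sigma
  have : IsNormingFamily rho sigma {f | f ∈ K rho sigma ∧ IsBoundedOn u b f} := by
    refine ⟨fun γ => ⟨hK.basis γ, hb.isBoundedOn_single hu γ⟩, ?_, ?_, ?_, ?_, ?_⟩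
    · rintro f ⟨hf, h⟩
      refine ⟨hK.symm f hf, fun I hI s c hc n => ?_⟩
      have h' := h I hI s c hc n
      have : ∀ k, pull u ((-f).filter (· ∈ I)) (b k) = -pull u (f.filter (· ∈ I)) (b k) :=
        fun k => by
          rw [pull_congr (ψ := f.filter (· ∈ I)) (r := -1)]
          · simp
          · intro t _
            by_cases htI : u t ∈ I <;> simp [htI]
      simp only [this, mul_neg, Finset.sum_neg_distrib, abs_neg]
      exact h'
    · rintro f ⟨hf, h⟩ J hJ
      refine ⟨hK.interval f hf J hJ, fun I hI s c hc n => ?_⟩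
      have h' : |∑ k ∈ Finset.range n, c k * pull u (f.filter (· ∈ J ∩ I)) (b k)| ≤ 4 * s := by
        convert h (J ∩ I) (hJ.inter hI) s c hc n
      have hfil : (f.filter (· ∈ J)).filter (· ∈ I) = f.filter (· ∈ J ∩ I) := by
        ext α
        simp only [Finsupp.filter_apply, Set.mem_inter_iff]
        split_ifs <;> tauto
      rw [← hfil] at h'
      convert h'
    · intro j d φ hj hd hφ hsep
      have hmem := hK.even j d φ hj hd (fun k hk => (hφ k hk).1) hsep
      exact ⟨hmem, hb.isBoundedOn_weighted hu (by omega) (fun k hk => (hφ k hk).2) hsep hmem⟩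
    · intro j d φ hj hd hφ hsep hspec
      have hmem := hK.special j d φ hj hd (fun k hk => (hφ k hk).1) hsep
        (hspec.mono fun _ h => h.1)
      exact ⟨hmem, hb.isBoundedOn_weighted hu (by omega) (fun k hk => (hφ k hk).2) hsep hmem⟩
    · rintro f ⟨hf, hf'⟩ g ⟨hg, hg'⟩ x y hx hy hxy
      refine ⟨hK.convex hf hg hx hy hxy, fun I hI s c hc n => ?_⟩
      have hf1 := hf' I hI s c hc n
      have hg1 := hg' I hI s c hc n
      have : ∀ k, pull u ((x • f + y • g).filter (· ∈ I)) (b k) =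
          x * pull u (f.filter (· ∈ I)) (b k) + y * pull u (g.filter (· ∈ I)) (b k) := by
        intro k
        rw [pull_apply, pull_apply, pull_apply, Finsupp.mul_sum, Finsupp.mul_sum,
          ← Finsupp.sum_add]
        refine Finsupp.sum_congr fun t _ => ?_
        by_cases htI : u t ∈ I
        · simp [htI]; ring
        · simp [htI]
      have hsum : ∑ k ∈ Finset.range n, c k * pull u ((x • f + y • g).filter (· ∈ I)) (b k) =
          x * (∑ k ∈ Finset.range n, c k * pull u (f.filter (· ∈ I)) (b k)) +
          y * ∑ k ∈ Finset.range n, c k * pull u (g.filter (· ∈ I)) (b k) := by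
        rw [Finset.mul_sum, Finset.mul_sum, ← Finset.sum_add_distrib]
        refine Finset.sum_congr rfl fun k _ => ?_
        rw [this]
        ring
      rw [hsum]
      have hx' : (0 : ℝ) ≤ x := by exact_mod_cast hx
      have hy' : (0 : ℝ) ≤ y := by exact_mod_cast hy
      have hxy' : (x : ℝ) + y = 1 := by exact_mod_cast hxy
      refine (abs_add_le _ _).trans ?_
      rw [abs_mul, abs_mul, abs_of_nonneg hx', abs_of_nonneg hy']
      calc _ ≤ x * (4 * s) + y * (4 * s) := add_le_add (mul_le_mul_of_nonneg_left hf1 hx')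
            (mul_le_mul_of_nonneg_left hg1 hy')
        _ = 4 * s := by rw [← add_mul, hxy', one_mul]
  exact (hf _ this).2

theorem IsFlatBlock.kNorm_le_four_mul (hb : IsFlatBlock rho sigma u N b) (hu : StrictMono u)
    (a : ℕ →₀ ℝ) :
    kNorm rho sigma (Finsupp.mapDomain u (blockMap b a)) ≤ 4 * supNorm a := by
  classical
  refine kNorm_le fun f hf => (le_abs_self _).trans ?_
  have h := hb.isBoundedOn hu hf Set.univ Set.ordConnected_univ (supNorm a) a (abs_le_supNorm a)
    (a.support.sup id + 1)
  have hfil : f.filter (· ∈ (Set.univ : Set Omega1)) = f := by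
    ext
    simp
  change |pull u f (blockMap b a)| ≤ _
  rw [pull_blockMap, Finsupp.sum_of_support_subset (s := Finset.range (a.support.sup id + 1))]
  · rw [← hfil]
    convert h
  · intro k hk
    exact Finset.mem_range.2 (Nat.lt_succ_of_le (Finset.le_sup (f := id) hk))
  · simp

theorem IsFlatBlock.half_mul_le_kNorm (hb : IsFlatBlock rho sigma u N b) (hu : StrictMono u)
    (a : ℕ →₀ ℝ) :
    1 / 2 * supNorm a ≤ kNorm rho sigma (Finsupp.mapDomain u (blockMap b a)) := by
  classical
  obtain ⟨k, hk⟩ := exists_abs_eq_supNorm a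
  have : ∃ f ∈ K rho sigma, 1 / 2 < pull u f (b k) := by
    by_contra! h
    have := kNorm_le (x := Finsupp.mapDomain u (b k)) h
    rw [hb.norm k] at this
    norm_num at this
  obtain ⟨f, hf, hfk⟩ := this
  -- Restricting `f` to the interval spanned by the `k`-th block isolates the `k`-th coefficient.
  set I : Set Omega1 := Set.Ico (u (N k)) (u (N (k + 1))) with hI
  have hmem := (isNormingFamily_K rho sigma).interval f hf I Set.ordConnected_Ico
  have h1 : pull u (f.filter (· ∈ I)) (b k) = pull u f (b k) := by
    rw [pull_congr (ψ := f) (r := 1)]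
    · simp
    intro t ht
    have ht' := hb.block.mem_Ico k t ht
    rw [Finsupp.filter_apply_pos, one_mul]
    exact ⟨hu.monotone ht'.1, hu ht'.2⟩
  have h2 : ∀ l, l ≠ k → pull u (f.filter (· ∈ I)) (b l) = 0 := by
    intro l hl
    rw [pull_congr (ψ := f) (r := 0)]
    · simp
    intro t ht
    have ht' := hb.block.mem_Ico l t ht
    rw [Finsupp.filter_apply_neg, zero_mul]
    rintro ⟨h3, h4⟩
    have h3 := hu.le_iff_le.1 h3
    have h4 := hu.lt_iff_lt.1 h4
    have h5 : k < l + 1 := hb.block.strictMono.lt_iff_lt.1 (h3.trans_lt ht'.2)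
    have h6 : l < k + 1 := hb.block.strictMono.lt_iff_lt.1 (ht'.1.trans_lt h4)
    omega
  have h3 : pull u (f.filter (· ∈ I)) (blockMap b a) = a k * pull u f (b k) := by
    rw [pull_blockMap, Finsupp.sum, Finset.sum_eq_single k, h1]
    · intro l _ hl
      rw [h2 l hl, mul_zero]
    · intro h
      rw [Finsupp.notMem_support_iff.1 h, zero_mul]
  have h4 : |pull u (f.filter (· ∈ I)) (blockMap b a)| ≤ _ := abs_pairing_le_kNorm
    (by convert hmem) _
  refine le_trans ?_ h4
  rw [h3, abs_mul, hk, mul_comm]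
  exact mul_le_mul_of_nonneg_left (hfk.le.trans (le_abs_self _)) (supNorm_nonneg a)

end Flat

/-! ### A copy of `c₀` -/

/-- The space `𝔛` contains a copy of `c₀`: along an increasing sequence of ordinals either the norm
is equivalent to the supremum norm far out, or there is a flat normalized block sequence. -/
theorem exists_c0_embedding (rho : Omega1 → Omega1 → ℕ) (sigma : CodeSeq ℕ → ℕ) :
    ∃ (L : (ℕ →₀ ℝ) →ₗ[ℝ] (Omega1 →₀ ℝ)) (c C : ℝ), 0 < c ∧
      ∀ a, c * supNorm a ≤ kNorm rho sigma (L a) ∧ kNorm rho sigma (L a) ≤ C * supNorm a := by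
  obtain ⟨u, hu⟩ := exists_strictMono_nat
  by_cases h : ∃ (n : ℕ) (δ : ℝ), 0 < δ ∧ ∀ a : ℕ →₀ ℝ, (∀ i, a i ≠ 0 → n ≤ i) →
      δ * kNorm rho sigma (Finsupp.mapDomain u a) ≤ supNorm a
  · obtain ⟨n, δ, hδ, h⟩ := h
    have hb : IsBlockIn (fun k => n + k) fun k => Finsupp.single (n + k) 1 := by
      refine ⟨fun i j hij => by simpa using hij, fun k i hi => ?_⟩
      rw [Finsupp.single_apply] at hi
      split_ifs at hi with hki
      · omega
      · exact absurd rfl hi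
    refine ⟨(Finsupp.lmapDomain ℝ ℝ u).comp (blockMap fun k => Finsupp.single (n + k) 1), 1, δ⁻¹,
      one_pos, fun a => ?_⟩
    have hn := hb.supNorm_blockMap (fun k => supNorm_single _) a
    constructor
    · rw [one_mul, ← hn]
      exact supNorm_le_kNorm hu _
    · have h' := h _ fun i hi => hb.le_of_ne_zero a hi
      rw [hn] at h'
      rw [inv_mul_eq_div, le_div_iff₀ hδ, mul_comm]
      exact h'
  · push Not at h
    have hfar : ∀ n, ∃ x : ℕ →₀ ℝ, (∀ i, x i ≠ 0 → n ≤ i) ∧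
        (kNorm rho sigma (Finsupp.mapDomain u x) = 1 ∧
          rhoMax rho u n * supNorm x ≤ (1 / 2) ^ (n + 1)) := by
      intro n
      have hR : (0 : ℝ) < rhoMax rho u n + 1 := by positivity
      obtain ⟨a, ha, hlt⟩ := h n ((1 / 2) ^ (n + 1) / (rhoMax rho u n + 1)) (by positivity)
      set q := kNorm rho sigma (Finsupp.mapDomain u a) with hq
      have hqpos : 0 < q := by
        by_contra! hq0
        have : (1 / 2 : ℝ) ^ (n + 1) / (rhoMax rho u n + 1) * q ≤ 0 :=
          mul_nonpos_of_nonneg_of_nonpos (by positivity) hq0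
        exact absurd ((supNorm_nonneg a).trans_lt hlt) (not_lt.2 this)
      have hnorm : ∀ r : ℝ, 0 ≤ r →
          kNorm rho sigma (Finsupp.mapDomain u (r • a)) = r * q := fun r hr => by
        rw [Finsupp.mapDomain_smul]
        have := norm_smul r (show C00 rho sigma from Finsupp.mapDomain u a)
        rwa [Real.norm_of_nonneg hr] at this
      refine ⟨q⁻¹ • a, fun i hi => ha i fun h => hi (by simp [h]), ?_, ?_⟩
      · rw [hnorm _ (inv_nonneg.2 hqpos.le), inv_mul_cancel₀ hqpos.ne']
      · rw [supNorm_smul, abs_of_pos (inv_pos.2 hqpos)]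
        have h1 : q⁻¹ * supNorm a ≤ (1 / 2) ^ (n + 1) / (rhoMax rho u n + 1) := by
          rw [inv_mul_eq_div, div_le_iff₀ hqpos]
          exact hlt.le
        rw [le_div_iff₀ hR] at h1
        have h2 : 0 ≤ q⁻¹ * supNorm a := mul_nonneg (inv_nonneg.2 hqpos.le) (supNorm_nonneg a)
        linarith
    obtain ⟨N, b, hb, -, hQ⟩ := exists_isBlockIn hfar 0
    have hflat : IsFlatBlock rho sigma u N b := by
      refine ⟨hb, fun k => (hQ k).1, fun k => (hQ k).2.trans ?_⟩
      exact pow_le_pow_of_le_one (by norm_num) (by norm_num)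
        (Nat.succ_le_succ (hb.strictMono.id_le k))
    exact ⟨(Finsupp.lmapDomain ℝ ℝ u).comp (blockMap b), 1 / 2, 4, by norm_num, fun a =>
      ⟨hflat.half_mul_le_kNorm hu a, hflat.kNorm_le_four_mul hu a⟩⟩

end LongC0

/-- The space `𝔛` is not distortable: every equivalent norm on it has distortion `1`. -/
theorem mainTheorem10
    (rho : LongC0.Omega1 → LongC0.Omega1 → ℕ) (hrho : LongC0.IsRhoFunction rho)
    (sigma : LongC0.CodeSeq ℕ → ℕ) (hsigma : LongC0.IsCoding sigma)
    (N : Seminorm ℝ (LongC0.SpaceX rho sigma)) (hN : LongC0.IsEquivalentNorm N) :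
    LongC0.distortion N = 1 := by
  obtain ⟨L, c, C, hc, hL⟩ := LongC0.exists_c0_embedding rho sigma
  let L' : (ℕ →₀ ℝ) →ₗ[ℝ] LongC0.C00 rho sigma := L
  have hL' : ∀ a, ‖UniformSpace.Completion.toComplₗᵢ (𝕜 := ℝ) (L' a)‖ =
      LongC0.kNorm rho sigma (L a) := fun a =>
    (UniformSpace.Completion.toComplₗᵢ (𝕜 := ℝ)).norm_map (L' a)
  exact LongC0.distortion_eq_one_of_c0 hN
    ((UniformSpace.Completion.toComplₗᵢ (𝕜 := ℝ)).toLinearMap.comp L') hc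
    (fun a => (hL a).1.trans (hL' a).ge) (fun a => (hL' a).le.trans (hL a).2)
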